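/- Notation. Let $K$ be a field and $n\ge 1$. The field of multivariate Laurent series is defined recursively by $K\langle\langle x_1,\ldots,x_n\rangle\rangle := K\langle\langle x_1,\ldots,x_{n-1}\rangle\rangle((x_n))$; equivalently, it consists of the formal series $\sum_{i\in\mathbb Z^n} a(i)x_1^{i_1}\cdots x_n^{i_n}$ with coefficients in $K$ whose support is well-ordered for the order on $\mathbb Z^n$ in which $i\prec j$ if and only if $i\ne j$ and $i_k<j_k$ for the largest index $k$ with $i_k\neq j_k$. An element $f$ of $K[[x_1,\ldots,x_n]]$ or of $K\langle\langle x_1,\ldots,x_n\rangle\rangle$ is algebraic if there are $A_0,\ldots,A_m\in K[x_1,\ldots,x_n]$, not all zero, with $\sum_{i=0}^m A_if^i=0$. Its degree is the least positive integer $m$ for which such a relation exists. The height of a nonzero $P(Y)\in K[x_1,\ldots,x_n][Y]$ is the maximum of the total degrees of its coefficients, and the height of $f$ is the minimum of the heights of the nonzero $P(Y)\in K[x_1,\ldots,x_n][Y]$ with $P(f)=0$. The diagonal of $f=\sum_{i} a(i_1,\ldots,i_n)x_1^{i_1}\cdots x_n^{i_n}$ is $\Delta(f):=\sum_{k} a(k,\ldots,k)x^k$,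 an element of $K[[x]]$ if $f\in K[[x_1,\ldots,x_n]]$ and of $K((x))$ if $f\in K\langle\langle x_1,\ldots,x_n\rangle\rangle$. Theorem. There is a computable function $A=A(n,d,h)$ of the natural numbers $n,d,h$, with values in the natural numbers, such that for every field $K$ of characteristic $p>0$, every $n\ge 1$ and all natural numbers $d,h$, the following hold with $A=A(n,d,h)$. (a) If $f\in K[[x_1,\ldots,x_n]]$ is an algebraic power series of degree at most $d$ and height at most $h$, then $\Delta(f)\in K[[x]]$ is algebraic of degree at most $p^A$ and height at most $A^2p^{A+1}$. (b) If $f\in K\langle\langle x_1,\ldots,x_n\rangle\rangle$ is an algebraic Laurent series of degree at most $d$ and height at most $h$, then $\Delta(f)\in K((x))$ is algebraic of degree at most $p^A$ and height at most $A^2p^{A+1}$. -/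

import Mathlib

open Polynomial

/-! ### Degree and height of an algebraic element -/

/-- The degree of an algebraic element `f`: the least positive integer `m` for which there are
`A₀, …, Aₘ` in the polynomial ring `R`, not all zero, with `∑ Aᵢ f ^ i = 0`. -/
noncomputable def algDegree (R : Type*) {S : Type*} [CommRing R] [CommRing S] [Algebra R S]
    (f : S) : ℕ :=
  sInf {m : ℕ | 0 < m ∧ ∃ P : R[X], P ≠ 0 ∧ P.natDegree ≤ m ∧ aeval f P = 0}

/-- The height of a polynomial `P(Y)` with coefficients in the polynomial ring `R`: the maximum of
the (total) degrees of its coefficients; `deg` is the degree function on `R`. -/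
def coeffHeight {R : Type*} [CommRing R] (deg : R → ℕ) (P : R[X]) : ℕ :=
  P.support.sup fun i => deg (P.coeff i)

/-- The (naive) height of an algebraic element `f`: the minimum of the heights of the nonzero
polynomials over the polynomial ring `R` that vanish at `f`. -/
noncomputable def algHeight {R S : Type*} [CommRing R] [CommRing S] [Algebra R S]
    (deg : R → ℕ) (f : S) : ℕ :=
  sInf {H : ℕ | ∃ P : R[X], P ≠ 0 ∧ aeval f P = 0 ∧ coeffHeight deg P = H}

/-! ### Fields of multivariate Laurent series -/

/-- The exponents `(i₁, …, iₙ) ∈ ℤⁿ` with the order `i ≺ j` iff `iₖ < jₖ` for the largest index `k`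
at which they differ (`Lex` alone would use the smallest such index, whence the dual). -/
abbrev LexExponent (n : ℕ) : Type := Lex ((Fin n)ᵒᵈ → ℤ)

/-- The field `K⟨⟨x₁, …, xₙ⟩⟩ = K((x₁))((x₂))⋯((xₙ))`: the formal series with exponents in `ℤⁿ`
whose support is well ordered for `≺`. -/
abbrev MvLaurentSeries (n : ℕ) (K : Type*) [Field K] : Type _ := HahnSeries (LexExponent n) K

/-- The inclusion `K[x₁, …, xₙ] → K⟨⟨x₁, …, xₙ⟩⟩`, sending `xᵢ` to the monomial `xᵢ`. -/
noncomputable instance MvLaurentSeries.algebraMvPolynomial (n : ℕ) (K : Type*) [Field K] :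
    Algebra (MvPolynomial (Fin n) K) (MvLaurentSeries n K) :=
  (MvPolynomial.aeval (R := K) fun i : Fin n =>
    (HahnSeries.single (toLex (Pi.single (OrderDual.toDual i) (1 : ℤ))) (1 : K) :
      MvLaurentSeries n K)).toRingHom.toAlgebra

/-! ### Diagonals -/

/-- The diagonal `∑ a(k, …, k) t ^ k` of a power series in `n` variables. -/
noncomputable def diagPowerSeries {n : ℕ} {K : Type*} [Field K]
    (f : MvPowerSeries (Fin n) K) : PowerSeries K :=
  PowerSeries.mk fun k => MvPowerSeries.coeff (Finsupp.equivFunOnFinite.symm fun _ => k) f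

theorem LexExponent.const_lt_const {n : ℕ} [NeZero n] {a b : ℤ} (h : a < b) :
    (toLex (fun _ : (Fin n)ᵒᵈ => a) : LexExponent n) < toLex (fun _ : (Fin n)ᵒᵈ => b) :=
  ⟨⊥, fun _ hj => absurd hj not_lt_bot, h⟩

/-- The diagonal `∑ a(k, …, k) x ^ k` of a Laurent series in `n ≥ 1` variables. -/
def diagLaurentSeries {n : ℕ} [NeZero n] {K : Type*} [Field K]
    (f : MvLaurentSeries n K) : LaurentSeries K where
  coeff k := f.coeff (toLex fun _ => k)
  isPWO_support' := by
    refine Set.partiallyWellOrderedOn_iff_exists_lt.2 fun u hu => ?_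
    obtain ⟨a, b, hab, h⟩ := Set.partiallyWellOrderedOn_iff_exists_lt.1 f.isPWO_support
      (fun m => toLex fun _ => u m) hu
    exact ⟨a, b, hab, not_lt.1 fun hlt => (LexExponent.const_lt_const hlt).not_ge h⟩

/-! The engine is the decomposition `u = ∑ x^r u_r^p`, with `0 ≤ r_i < p`, which is unique for
Laurent series. Let `K` be perfect first. An irreducible factor `M` of a polynomial of height at
most `h`, chosen with `M(f) = 0`, has minimal degree in `Y` by Gauss's lemma, and its degree in each
`x_i` is at most `h`. Uniqueness of the decomposition forces `M'(f) ≠ 0`. Consider the `N =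
(d+1)(h+1)^n` elements `x^m f^j / M'(f)` with `m_i ≤ h` and `j ≤ d`. Their `K`-span contains `f` and
is stable under every `u ↦ u_r`: the Hasse derivative of order `p-1` in `Y` of `G M^(p-1)` takes the
value `G(f) M'(f)^(p-1)` at `f` and involves only powers of `Y^p`
(`exists_boxMonomial_div_eq_sum_pow`).

The diagonal of `∑ x^r u_r^p` is `∑ x^j Δ(u_(j,…,j))^p`, so the diagonals `e_a` of the generators
satisfy a system `e_a = ∑ M_ab e_b^p` with `deg M_ab < p`. Iterating it writes each `Δ(f)^(p^i)`, `0
≤ i ≤ N`, as a combination of the `N` elements `e_b^(p^N)` with coefficients of degree less than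
`p^N`. Counting unknowns yields a relation `∑ A_i Δ(f)^(p^i) = 0` with `deg A_i ≤ N p^N`
(`exists_annihilating_of_frobenius_system`), so `A = N` works.

For general `K`, extend scalars to the algebraic closure and bring the relation back by a linear
functional (`LaurentSeries.exists_annihilating_of_map`). Power series are treated as Laurent series.
-/

/-! ### Polynomials of minimal degree and bounded height -/

/-- In `K[x₁, …, xₙ, Y]`, a domain, the degree in one variable is additive on products, so it cannot
grow when passing to a factor. -/
theorem MvPolynomial.degreeOf_coeff_le_of_dvd {n : ℕ} {K : Type*} [Field K]
    {A Q : (MvPolynomial (Fin n) K)[X]} (hQ : Q ≠ 0) (hA : A ∣ Q) {h : ℕ} {i : Fin n}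
    (hb : ∀ k, (Q.coeff k).degreeOf i ≤ h) (k : ℕ) : (A.coeff k).degreeOf i ≤ h := by
  obtain ⟨B, rfl⟩ := hA
  have hA0 := left_ne_zero_of_mul hQ
  have hB0 := right_ne_zero_of_mul hQ
  let e := MvPolynomial.finSuccEquiv K n
  have h1 : (e.symm (A * B)).degreeOf i.succ ≤ h := by
    rw [MvPolynomial.degreeOf_le_iff]
    intro m hm
    have h2 : m.tail ∈ ((A * B).coeff (m 0)).support := by
      have := (MvPolynomial.mem_support_coeff_finSuccEquiv (f := e.symm (A * B)) (i := m 0)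
        (m := m.tail)).2 (by rwa [Finsupp.cons_tail])
      rwa [show MvPolynomial.finSuccEquiv K n (e.symm (A * B)) = A * B from
        e.apply_symm_apply _] at this
    exact MvPolynomial.degreeOf_le_iff.1 (hb (m 0)) _ h2
  rw [map_mul, MvPolynomial.degreeOf_mul_eq (by simpa using hA0) (by simpa using hB0)] at h1
  have h3 := MvPolynomial.degreeOf_coeff_finSuccEquiv (e.symm A) i k
  rw [show MvPolynomial.finSuccEquiv K n (e.symm A) = A from e.apply_symm_apply _] at h3
  omega

/-- Some irreducible factor of `Q` vanishes at `f`. By Gauss's lemma it stays irreducible over the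
fraction field, hence is the minimal polynomial up to a scalar. Divisibility of `Q` is kept for the
sake of the height. -/
theorem Polynomial.exists_dvd_aeval_eq_zero_natDegree_minimal {R S : Type*} [CommRing R]
    [IsDomain R] [UniqueFactorizationMonoid R] [Field S] [Algebra R S] [FaithfulSMul R S]
    {f : S} {Q : R[X]} (hQ : Q ≠ 0) (hQf : aeval f Q = 0) :
    ∃ P : R[X], P ∣ Q ∧ P ≠ 0 ∧ aeval f P = 0 ∧
      ∀ P₁ : R[X], P₁ ≠ 0 → aeval f P₁ = 0 → P.natDegree ≤ P₁.natDegree := by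
  have hinj : Function.Injective (algebraMap R S) := FaithfulSMul.algebraMap_injective R S
  obtain ⟨P, hPirr, hPQ, hPf⟩ : ∃ P : R[X], Irreducible P ∧ P ∣ Q ∧ aeval f P = 0 := by
    clear hinj
    induction Q using WfDvdMonoid.induction_on_irreducible with
    | zero => exact absurd rfl hQ
    | unit u hu => exact absurd hQf (hu.map (aeval f)).ne_zero
    | mul a i ha hi ih =>
      rw [map_mul, mul_eq_zero] at hQf
      rcases hQf with h | h
      · exact ⟨i, hi, dvd_mul_right _ _, h⟩
      · obtain ⟨P, h1, h2, h3⟩ := ih ha h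
        exact ⟨P, h1, h2.mul_left _, h3⟩
  refine ⟨P, hPQ, hPirr.ne_zero, hPf, fun P₁ h0 h1 => ?_⟩
  have hdeg : P.natDegree ≠ 0 := by
    intro h
    rw [eq_C_of_natDegree_eq_zero h, aeval_C, map_eq_zero_iff _ hinj] at hPf
    exact hPirr.ne_zero (by rw [eq_C_of_natDegree_eq_zero h, hPf, C_0])
  let F := FractionRing R
  let _ : Algebra F S := FractionRing.liftAlgebra R S
  have hirr : Irreducible (P.map (algebraMap R F)) :=
    ((hPirr.isPrimitive hdeg).irreducible_iff_irreducible_map_fraction_map).1 hPirr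
  have hmin := minpoly.eq_of_irreducible (x := f) hirr (by rwa [aeval_map_algebraMap])
  have hFinj : Function.Injective (algebraMap R F) := IsFractionRing.injective R F
  have hle := natDegree_le_natDegree (minpoly.degree_le_of_ne_zero F f
    (p := P₁.map (algebraMap R F)) ((Polynomial.map_ne_zero_iff hFinj).2 h0)
    (by rwa [aeval_map_algebraMap]))
  rw [← hmin, natDegree_mul_C (by simpa using hirr.ne_zero), natDegree_map_eq_of_injective hFinj,
    natDegree_map_eq_of_injective hFinj] at hle
  exact hle

/-! ### Hasse derivatives and p-th powers -/

/-- Write `P = (X - f) P₁`. The left side is the coefficient of order `m` in the Taylor expansion of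
`Q P₁^m (X - f)^m` at `f`, and `P₁(f) = P'(f)`. -/
theorem Polynomial.eval_hasseDeriv_mul_pow {S : Type*} [CommRing S] (P Q : S[X]) {f : S}
    (hP : P.eval f = 0) (m : ℕ) :
    (hasseDeriv m (Q * P ^ m)).eval f = Q.eval f * (derivative P).eval f ^ m := by
  obtain ⟨P₁, rfl⟩ := dvd_iff_isRoot.2 hP
  rw [← taylor_coeff, taylor_mul, taylor_pow, taylor_mul,
    show taylor f (X - C f) = X by simp [taylor_X, taylor_C], mul_pow, mul_left_comm,
    coeff_X_pow_mul', if_pos le_rfl, Nat.sub_self, mul_coeff_zero, coeff_zero_eq_eval_zero (_ ^ m),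
    eval_pow, ← coeff_zero_eq_eval_zero, taylor_coeff_zero, taylor_coeff_zero]
  simp [derivative_mul]

theorem Polynomial.hasseDeriv_map {R S : Type*} [CommRing R] [CommRing S] (φ : R →+* S) (k : ℕ)
    (G : R[X]) : hasseDeriv k (G.map φ) = (hasseDeriv k G).map φ := by
  ext m
  simp [hasseDeriv_coeff]

theorem Polynomial.aeval_hasseDeriv_mul_pow {R S : Type*} [CommRing R] [CommRing S] [Algebra R S]
    (P Q : R[X]) {f : S} (hP : aeval f P = 0) (m : ℕ) :
    aeval f (hasseDeriv m (Q * P ^ m)) = aeval f Q * aeval f (derivative P) ^ m := by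
  have h := eval_hasseDeriv_mul_pow (P.map (algebraMap R S)) (Q.map (algebraMap R S)) (f := f)
    (by rwa [eval_map_algebraMap]) m
  rwa [← Polynomial.map_pow, ← Polynomial.map_mul, hasseDeriv_map, derivative_map,
    eval_map_algebraMap, eval_map_algebraMap, eval_map_algebraMap] at h

/-- The monomial `x ^ m * Y ^ j`, where `m i ≤ h` and `j ≤ d`. -/
noncomputable def boxMonomial (K : Type*) [Field K] {n d h : ℕ}
    (b : Fin (d + 1) × (Fin n → Fin (h + 1))) : (MvPolynomial (Fin n) K)[X] :=
  Polynomial.monomial b.1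
    (MvPolynomial.monomial (Finsupp.equivFunOnFinite.symm fun i => (b.2 i : ℕ)) 1)

theorem Polynomial.induction_on_box {K : Type*} [Field K] {n D H : ℕ}
    {M : (MvPolynomial (Fin n) K)[X] → Prop} (h0 : M 0) (hadd : ∀ A B, M A → M B → M (A + B))
    (hmono : ∀ k < D, ∀ m : Fin n →₀ ℕ, (∀ i, m i < H) → ∀ a : K,
      M (Polynomial.monomial k (MvPolynomial.monomial m a)))
    (G : (MvPolynomial (Fin n) K)[X]) (hd : G.natDegree < D)
    (hG : ∀ k i, (G.coeff k).degreeOf i < H) : M G := by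
  rw [G.as_sum_range]
  refine Finset.sum_induction _ M hadd h0 fun k hk => ?_
  rw [(G.coeff k).as_sum, map_sum]
  refine Finset.sum_induction _ M hadd h0 fun m hm => ?_
  refine hmono k (by have := Finset.mem_range.1 hk; omega) m (fun i => ?_) _
  exact (MvPolynomial.degreeOf_le_iff.1 le_rfl m hm).trans_lt (hG k i)

theorem exists_eq_sum_boxMonomial {K : Type*} [Field K] {n d h : ℕ}
    (G : (MvPolynomial (Fin n) K)[X]) (hd : G.natDegree ≤ d)
    (hG : ∀ k i, (G.coeff k).degreeOf i ≤ h) :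
    ∃ c : Fin (d + 1) × (Fin n → Fin (h + 1)) → K,
      G = ∑ b, C (MvPolynomial.C (c b)) * boxMonomial K b := by
  refine Polynomial.induction_on_box (D := d + 1) (H := h + 1) (M := fun G => ∃ c : _ → K,
      G = ∑ b, C (MvPolynomial.C (c b)) * boxMonomial K b) ⟨0, by simp⟩ ?_ ?_ G
      (Nat.lt_succ_of_le hd) fun k i => Nat.lt_succ_of_le (hG k i)
  · rintro A B ⟨c, rfl⟩ ⟨c', rfl⟩
    exact ⟨c + c', by simp [add_mul, Finset.sum_add_distrib]⟩
  · intro k hk m hm a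
    refine ⟨Pi.single (⟨k, hk⟩, fun i => ⟨m i, hm i⟩) a, ?_⟩
    rw [Finset.sum_eq_single (⟨k, hk⟩, fun i => ⟨m i, hm i⟩)]
    · rw [Pi.single_eq_same, boxMonomial, C_mul_monomial, MvPolynomial.C_mul_monomial, mul_one]
      congr 2
      ext i
      simp
    · intro b _ hb
      rw [Pi.single_eq_of_ne hb]
      simp
    · simp

/-- Lucas's theorem: modulo `p` only the last digit of `k` matters. -/
theorem Nat.cast_choose_pred_eq {R : Type*} [CommRing R] {p : ℕ} [Fact p.Prime] [CharP R p]
    (k : ℕ) : ((k.choose (p - 1) : ℕ) : R) = if k % p = p - 1 then 1 else 0 := by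
  have hp := (Fact.out : p.Prime).two_le
  have h := Choose.choose_modEq_choose_mod_mul_choose_div_nat (n := k) (k := p - 1) (p := p)
  rw [Nat.mod_eq_of_lt (a := p - 1) (by omega), Nat.div_eq_of_lt (a := p - 1) (by omega),
    Nat.choose_zero_right, mul_one] at h
  rw [(CharP.natCast_eq_natCast R p).2 h]
  split_ifs with hk
  · rw [hk, Nat.choose_self, Nat.cast_one]
  · have := Nat.mod_lt k (show 0 < p by omega)
    rw [Nat.choose_eq_zero_of_lt (by omega), Nat.cast_zero]

/-- By Lucas, a monomial in `Y^k` survives only if `k ≡ -1` modulo `p`, and then its new exponent is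
a multiple of `p`. Division of each `x`-exponent by `p` gives the quotient inside the p-th power and
the remainder `r`; perfectness supplies the p-th root of the coefficient. -/
theorem exists_hasseDeriv_eq_sum_pow {K : Type*} [Field K] {p : ℕ} [Fact p.Prime] [CharP K p]
    [PerfectRing K p] {n d h : ℕ} (G : (MvPolynomial (Fin n) K)[X])
    (hd : G.natDegree < p * (d + 1)) (hG : ∀ k i, (G.coeff k).degreeOf i < p * (h + 1)) :
    ∃ c : (Fin n → Fin p) → Fin (d + 1) × (Fin n → Fin (h + 1)) → K,
      hasseDeriv (p - 1) G =
        ∑ r : Fin n → Fin p,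
          C (MvPolynomial.monomial (Finsupp.equivFunOnFinite.symm fun i => (r i : ℕ)) 1) *
            (∑ b, C (MvPolynomial.C (c r b)) * boxMonomial K b) ^ p := by
  have hp := (Fact.out : p.Prime)
  refine Polynomial.induction_on_box (D := p * (d + 1)) (H := p * (h + 1))
      (M := fun G => ∃ c : _ → _ → K, hasseDeriv (p - 1) G = ∑ r : Fin n → Fin p,
          C (MvPolynomial.monomial (Finsupp.equivFunOnFinite.symm fun i => (r i : ℕ)) 1) *
            (∑ b, C (MvPolynomial.C (c r b)) * boxMonomial K b) ^ p)
      ⟨0, by simp [hp.ne_zero]⟩ ?_ ?_ G hd hG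
  · rintro A B ⟨c, hc⟩ ⟨c', hc'⟩
    refine ⟨c + c', ?_⟩
    rw [map_add, hc, hc', ← Finset.sum_add_distrib]
    refine Finset.sum_congr rfl fun r _ => ?_
    rw [← mul_add, ← add_pow_char]
    simp [add_mul, Finset.sum_add_distrib]
  · intro k hk m hm a
    rw [hasseDeriv_monomial, ← map_natCast (MvPolynomial.C (σ := Fin n) (R := K)),
      Nat.cast_choose_pred_eq]
    split_ifs with hkp
    · have hm' : ∀ i, m i % p < p := fun i => Nat.mod_lt _ hp.pos
      have hmd : ∀ i, m i / p < h + 1 := fun i => Nat.div_lt_of_lt_mul (hm i)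
      let r₀ : Fin n → Fin p := fun i => ⟨m i % p, hm' i⟩
      let b₀ : Fin (d + 1) × (Fin n → Fin (h + 1)) :=
        (⟨k / p, Nat.div_lt_of_lt_mul hk⟩, fun i => ⟨m i / p, hmd i⟩)
      obtain ⟨a', rfl⟩ := surjective_frobenius K p a
      refine ⟨Pi.single r₀ (Pi.single b₀ a'), ?_⟩
      rw [Finset.sum_eq_single r₀ _ (by simp), Finset.sum_eq_single b₀ _ (by simp)]
      · rw [Pi.single_eq_same, Pi.single_eq_same, boxMonomial, C_mul_monomial,
          MvPolynomial.C_mul_monomial, MvPolynomial.C_mul_monomial, mul_one a', one_mul, monomial_pow,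
          MvPolynomial.monomial_pow, C_mul_monomial, MvPolynomial.monomial_mul, one_mul,
          frobenius_def]
        -- Here `k % p = p - 1`, so subtracting `p - 1` removes exactly the remainder.
        have e1 : k - (p - 1) = b₀.1 * p := by
          have := Nat.div_add_mod k p
          simp only [b₀]
          rw [mul_comm]
          omega
        rw [e1]
        congr 2
        congr 1
        ext i
        simpa [r₀, b₀] using (Nat.mod_add_div (m i) p).symm
      · intro b _ hb
        rw [Pi.single_eq_same, Pi.single_eq_of_ne hb]
        simp
      · intro r _ hr
        rw [Pi.single_eq_of_ne hr]
        simp [hp.ne_zero]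
    · exact ⟨0, by simp [hp.ne_zero]⟩

theorem MvPolynomial.degreeOf_coeff_mul_le {σ R : Type*} [CommRing R] {i : σ} {u v : ℕ}
    {A B : (MvPolynomial σ R)[X]} (hA : ∀ k, (A.coeff k).degreeOf i ≤ u)
    (hB : ∀ k, (B.coeff k).degreeOf i ≤ v) (k : ℕ) : ((A * B).coeff k).degreeOf i ≤ u + v := by
  rw [Polynomial.coeff_mul]
  refine (MvPolynomial.degreeOf_sum_le i _ _).trans (Finset.sup_le fun j _ => ?_)
  exact (MvPolynomial.degreeOf_mul_le _ _ _).trans (add_le_add (hA _) (hB _))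

theorem MvPolynomial.degreeOf_coeff_pow_le {σ R : Type*} [CommRing R] {i : σ} {u : ℕ}
    {A : (MvPolynomial σ R)[X]} (hA : ∀ k, (A.coeff k).degreeOf i ≤ u) (m k : ℕ) :
    ((A ^ m).coeff k).degreeOf i ≤ m * u := by
  induction m generalizing k with
  | zero =>
    rw [pow_zero, Polynomial.coeff_one]
    split_ifs
    · rw [← MvPolynomial.C_1, MvPolynomial.degreeOf_C, zero_mul]
    · simp
  | succ m ih =>
    rw [pow_succ, add_mul, one_mul]
    exact MvPolynomial.degreeOf_coeff_mul_le ih hA k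

theorem natDegree_boxMonomial_le {K : Type*} [Field K] {n d h : ℕ}
    (b : Fin (d + 1) × (Fin n → Fin (h + 1))) : (boxMonomial K b).natDegree ≤ d :=
  (natDegree_monomial_le _).trans (Nat.le_of_lt_succ b.1.2)

theorem degreeOf_coeff_boxMonomial_le {K : Type*} [Field K] {n d h : ℕ}
    (b : Fin (d + 1) × (Fin n → Fin (h + 1))) (k : ℕ) (i : Fin n) :
    ((boxMonomial K b).coeff k).degreeOf i ≤ h := by
  rw [boxMonomial, coeff_monomial]
  split_ifs
  · rw [MvPolynomial.degreeOf_monomial_eq _ _ one_ne_zero]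
    simpa using Nat.le_of_lt_succ (b.2 i).2
  · simp

/-! ### A finite-dimensional space stable under the Cartier operators -/

section Cartier

variable {K S : Type*} [Field K] [Field S] {n : ℕ} [Algebra (MvPolynomial (Fin n) K) S]
  {p : ℕ} [Fact p.Prime] [CharP K p] [PerfectRing K p]

/-- Apply the Hasse derivative of order `p - 1` to `G P^(p-1)`, evaluate at `f`, and divide by
`P'(f)^p`: the factor `P'(f)^(p-1)` becomes `1 / P'(f)`. -/
theorem exists_boxMonomial_div_eq_sum_pow {f : S} {P : (MvPolynomial (Fin n) K)[X]} {d h : ℕ}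
    (hd : P.natDegree ≤ d) (hh : ∀ k i, (P.coeff k).degreeOf i ≤ h) (hPf : aeval f P = 0)
    (hP' : aeval f (derivative P) ≠ 0) (a : Fin (d + 1) × (Fin n → Fin (h + 1))) :
    ∃ c : (Fin n → Fin p) → Fin (d + 1) × (Fin n → Fin (h + 1)) → K,
      aeval f (boxMonomial K a) / aeval f (derivative P) =
        ∑ r : Fin n → Fin p,
          algebraMap (MvPolynomial (Fin n) K) S
            (MvPolynomial.monomial (Finsupp.equivFunOnFinite.symm fun i => (r i : ℕ)) 1) *
            (∑ b, algebraMap (MvPolynomial (Fin n) K) S (MvPolynomial.C (c r b)) *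
              (aeval f (boxMonomial K b) / aeval f (derivative P))) ^ p := by
  have hp := (Fact.out : p.Prime).pos
  -- With `t = d` and `t = h`: the product `G P^(p-1)` has degrees at most `p t`, so taking p-th
  -- roots returns to the same box.
  have key : ∀ t : ℕ, t + (p - 1) * t < p * (t + 1) := by
    intro t
    obtain ⟨q, rfl⟩ := Nat.exists_eq_add_of_lt hp
    simp only [Nat.zero_add, Nat.add_sub_cancel]
    nlinarith
  obtain ⟨c, hc⟩ := exists_hasseDeriv_eq_sum_pow (p := p) (d := d) (h := h)
    (boxMonomial K a * P ^ (p - 1))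
    ((natDegree_mul_le.trans (add_le_add (natDegree_boxMonomial_le a)
      (natDegree_pow_le.trans (Nat.mul_le_mul_left _ hd)))).trans_lt (key d))
    (fun k i => (MvPolynomial.degreeOf_coeff_mul_le (degreeOf_coeff_boxMonomial_le a · i)
      (MvPolynomial.degreeOf_coeff_pow_le (hh · i) _) k).trans_lt (key h))
  refine ⟨c, ?_⟩
  have h1 := congrArg (aeval f) hc
  rw [aeval_hasseDeriv_mul_pow _ _ hPf, map_sum] at h1
  simp only [map_mul, map_pow, map_sum, aeval_C] at h1
  simp only [← mul_div_assoc, ← Finset.sum_div, div_pow]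
  rw [← h1, div_eq_div_iff hP' (pow_ne_zero _ hP'), mul_assoc, ← pow_succ,
    Nat.sub_add_cancel hp]

/-- Only exponents divisible by `p` occur in `P`; the factor `X^(p-1)` moves them to the class of
`-1`, where the binomial coefficient is `1`. -/
theorem Polynomial.hasseDeriv_X_pow_mul_of_derivative_eq_zero {R : Type*} [CommRing R] [IsDomain R]
    [CharP R p] {P : R[X]} (hP : derivative P = 0) : hasseDeriv (p - 1) (X ^ (p - 1) * P) = P := by
  have hp := (Fact.out : p.Prime).two_le
  ext k
  rw [hasseDeriv_coeff, coeff_X_pow_mul, Nat.cast_choose_pred_eq]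
  split_ifs with hk
  · rw [one_mul]
  · rw [zero_mul]
    cases k with
    | zero => exact absurd (by rw [Nat.zero_add, Nat.mod_eq_of_lt (by omega)]) hk
    | succ k =>
      have h1 := congrArg (coeff · k) hP
      simp only [coeff_derivative, coeff_zero, mul_eq_zero] at h1
      refine (h1.resolve_right fun h2 => hk ?_).symm
      have h3 : p ∣ k + 1 := (CharP.cast_eq_zero_iff R p _).1 (by exact_mod_cast h2)
      obtain ⟨t, ht⟩ := h3
      rw [ht, Nat.mul_add_mod, Nat.mod_eq_of_lt (by omega)]

/-- If `P'` is nonzero, its smaller degree contradicts minimality. If `P' = 0`, then `P = ∑ x^r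
B_r^p`; by the uniqueness hypothesis `hS` every `B_r` vanishes at `f`, and `B_r` has smaller degree
than `P`, so all `B_r`, and hence `P`, are zero. -/
theorem aeval_derivative_ne_zero_of_minimal [FaithfulSMul (MvPolynomial (Fin n) K) S] {f : S}
    {P : (MvPolynomial (Fin n) K)[X]} (hP : P ≠ 0) (hPf : aeval f P = 0)
    (hmin : ∀ P₁ : (MvPolynomial (Fin n) K)[X], P₁ ≠ 0 → aeval f P₁ = 0 →
      P.natDegree ≤ P₁.natDegree)
    (hS : ∀ u : (Fin n → Fin p) → S, ∑ r : Fin n → Fin p,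
      algebraMap (MvPolynomial (Fin n) K) S
        (MvPolynomial.monomial (Finsupp.equivFunOnFinite.symm fun i => (r i : ℕ)) 1) * u r ^ p = 0 →
      ∀ r, u r = 0) :
    aeval f (derivative P) ≠ 0 := by
  have hp := (Fact.out : p.Prime)
  have hinj := FaithfulSMul.algebraMap_injective (MvPolynomial (Fin n) K) S
  have hpos : 0 < P.natDegree := natDegree_pos_of_aeval_root hP hPf fun x hx =>
    (map_eq_zero_iff _ hinj).1 hx
  intro hP'
  by_cases h0 : derivative P = 0
  · have h1 := Polynomial.hasseDeriv_X_pow_mul_of_derivative_eq_zero (p := p) h0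
    let h := (Finset.univ : Finset (Fin n)).sup fun i =>
      P.support.sup fun k => (P.coeff k).degreeOf i
    have hh : ∀ k i, (P.coeff k).degreeOf i ≤ h := by
      intro k i
      by_cases hk : k ∈ P.support
      · exact (Finset.le_sup (f := fun k => (P.coeff k).degreeOf i) hk).trans
          (Finset.le_sup (f := fun i => P.support.sup fun k => (P.coeff k).degreeOf i)
            (Finset.mem_univ i))
      · simp [notMem_support_iff.1 hk]
    -- Since `P' = 0`, `p` divides the degree of `P`, so the degree after multiplication by
    -- `X^(p-1)` is below `p (P.natDegree / p + 1)`.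
    obtain ⟨c, hc⟩ := exists_hasseDeriv_eq_sum_pow (p := p) (d := P.natDegree / p) (h := h)
      (X ^ (p - 1) * P)
      (by
        have hdvd : p ∣ P.natDegree := by
          have h2 := congrArg (coeff · (P.natDegree - 1)) h0
          simp only [coeff_derivative, coeff_zero, mul_eq_zero] at h2
          rw [Nat.sub_add_cancel hpos] at h2
          refine (CharP.cast_eq_zero_iff (MvPolynomial (Fin n) K) p _).1 ?_
          have h3 := h2.resolve_left (by simpa using hP)
          rwa [← Nat.cast_add_one, Nat.sub_add_cancel hpos] at h3
        have h2 := natDegree_mul_le (p := X ^ (p - 1)) (q := P)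
        rw [natDegree_X_pow] at h2
        have h3 := Nat.mul_div_cancel' hdvd
        have := hp.pos
        rw [mul_add, h3]
        omega)
      (by
        intro k i
        rw [coeff_X_pow_mul']
        split_ifs
        · have := hh (k - (p - 1)) i
          nlinarith [hp.pos]
        · simp [hp.pos])
    rw [h1] at hc
    have h2 : ∀ r, (∑ b, C (MvPolynomial.C (c r b)) * boxMonomial K b) = 0 := by
      intro r
      by_contra hne
      refine absurd (hmin _ hne ?_) (not_le.2 ?_)
      · refine hS (fun r => aeval f (∑ b, C (MvPolynomial.C (c r b)) * boxMonomial K b)) ?_ r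
        have h3 := congrArg (aeval f) hc
        rw [hPf, map_sum] at h3
        simpa only [map_mul, map_pow, aeval_C] using h3.symm
      · refine (natDegree_sum_le_of_forall_le _ _ (n := P.natDegree / p) fun b _ =>
          (natDegree_C_mul_le _ _).trans (natDegree_boxMonomial_le b)).trans_lt ?_
        exact Nat.div_lt_self hpos hp.one_lt
    exact hP (by rw [hc]; simp [h2, hp.ne_zero])
  · exact absurd (hmin _ h0 hP') (not_le.2 (natDegree_derivative_lt hpos.ne'))

/-- Write `f = f P'(f) / P'(f)`; the polynomial `Y P'(Y)` obeys the same bounds as `P`. -/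
theorem exists_eq_sum_boxMonomial_div {f : S} {P : (MvPolynomial (Fin n) K)[X]} {d h : ℕ}
    (hd : P.natDegree ≤ d) (hh : ∀ k i, (P.coeff k).degreeOf i ≤ h)
    (hP' : aeval f (derivative P) ≠ 0) :
    ∃ c : Fin (d + 1) × (Fin n → Fin (h + 1)) → K,
      f = ∑ b, algebraMap (MvPolynomial (Fin n) K) S (MvPolynomial.C (c b)) *
        (aeval f (boxMonomial K b) / aeval f (derivative P)) := by
  have h0 : P.natDegree ≠ 0 := fun h0 => hP' (by
    rw [eq_C_of_natDegree_eq_zero h0, derivative_C, map_zero])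
  obtain ⟨c, hc⟩ := exists_eq_sum_boxMonomial (d := d) (h := h) (X * derivative P)
    (natDegree_mul_le.trans (by
      have := natDegree_derivative_lt h0
      have := natDegree_X_le (R := MvPolynomial (Fin n) K)
      omega))
    (by
      intro k i
      rcases k with _ | k
      · simp
      · rw [coeff_X_mul, coeff_derivative]
        refine (MvPolynomial.degreeOf_mul_le _ _ _).trans ?_
        rw [show ((k : MvPolynomial (Fin n) K) + 1) = MvPolynomial.C ((k : K) + 1) by simp,
          MvPolynomial.degreeOf_C, add_zero]
        exact hh _ _)
  refine ⟨c, ?_⟩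
  have h1 := congrArg (aeval f) hc
  simp only [map_mul, map_sum, aeval_C, aeval_X] at h1
  simp only [← mul_div_assoc, ← Finset.sum_div]
  rw [← h1, mul_div_cancel_right₀ _ hP']

end Cartier

/-! ### Annihilating polynomials from Frobenius systems -/

theorem Polynomial.exists_natDegree_le_sum_mul_eq_zero {K ι : Type*} [Field K] [Fintype ι] {N q : ℕ}
    (hN : Fintype.card ι = N) (hq : 0 < q) (D : Fin (N + 1) → ι → K[X]) (hD : ∀ i b, (D i b).natDegree < q) :
    ∃ A : Fin (N + 1) → K[X], A ≠ 0 ∧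
      (∀ i, (A i).natDegree ≤ N * q) ∧ ∀ b, ∑ i, A i * D i b = 0 := by
  let L : (Fin (N + 1) → degreeLT K (N * q + 1)) →ₗ[K] (ι × Fin (N * q + q) → K) :=
    { toFun := fun x bk => (∑ i, (x i : K[X]) * D i bk.1).coeff bk.2
      map_add' := fun x y => by
        ext bk
        simp [add_mul, Finset.sum_add_distrib]
      map_smul' := fun c x => by
        ext bk
        simp [Finset.mul_sum] }
  have hfin : Module.finrank K (degreeLT K (N * q + 1)) = N * q + 1 := by
    rw [(degreeLTEquiv K (N * q + 1)).finrank_eq, Module.finrank_fin_fun]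
  have : FiniteDimensional K (degreeLT K (N * q + 1)) :=
    (degreeLTEquiv K (N * q + 1)).symm.finiteDimensional
  -- There are `(N + 1)(N q + 1)` unknown coefficients and only `N (N q + q)` equations.
  have hker : L.ker ≠ ⊥ := by
    refine LinearMap.ker_ne_bot_of_finrank_lt ?_
    rw [Module.finrank_fintype_fun_eq_card, Module.finrank_pi_fintype]
    simp only [hfin, Finset.sum_const, Finset.card_univ, Fintype.card_fin, Fintype.card_prod,
      smul_eq_mul, hN]
    nlinarith
  obtain ⟨x, hx, hx0⟩ := Submodule.exists_mem_ne_zero_of_ne_bot hker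
  have hdeg : ∀ i, (x i : K[X]).natDegree ≤ N * q := fun i =>
    natDegree_le_of_degree_le (Order.lt_succ_iff.1 (mem_degreeLT.1 (x i).2))
  refine ⟨fun i => x i, fun h => hx0 (_root_.funext fun i => Subtype.ext (by exact congrFun h i)), hdeg,
    fun b => ?_⟩
  ext k
  by_cases hk : k < N * q + q
  · exact congrFun (LinearMap.mem_ker.1 hx) (b, ⟨k, hk⟩)
  · refine coeff_eq_zero_of_natDegree_lt (lt_of_lt_of_le ?_ (not_lt.1 hk))
    refine (natDegree_sum_le_of_forall_le _ _ (n := N * q + (q - 1)) fun i _ =>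
      natDegree_mul_le.trans ?_).trans_lt (by omega)
    exact add_le_add (hdeg i) (Nat.le_sub_one_of_lt (hD i b))

section FrobeniusSystem

variable {K S ι : Type*} [Field K] [CommRing S] [Algebra K[X] S] [Fintype ι] {p : ℕ}
  [Fact p.Prime] [CharP S p]

/-- Substitute the system into itself, using additivity of Frobenius. The degrees stay in range
because `(p - 1) + p (p^k - 1) = p^(k+1) - 1`. -/
theorem exists_iterate_frobenius_system {e : ι → S} {M : ι → ι → K[X]}
    (hM : ∀ a b, (M a b).natDegree < p) (he : ∀ a, e a = ∑ b, algebraMap K[X] S (M a b) * e b ^ p)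
    (k : ℕ) : ∃ M' : ι → ι → K[X], (∀ a b, (M' a b).natDegree < p ^ k) ∧
      ∀ a, e a = ∑ b, algebraMap K[X] S (M' a b) * e b ^ p ^ k := by
  classical
  have hp := (Fact.out : p.Prime).pos
  induction k with
  | zero =>
    refine ⟨fun a b => if a = b then 1 else 0, fun a b => ?_, fun a => ?_⟩
    · dsimp only
      split_ifs <;> simp
    · simp
  | succ k ih =>
    obtain ⟨M', hM', he'⟩ := ih
    refine ⟨fun a c => ∑ b, M a b * M' b c ^ p, fun a c => ?_, fun a => ?_⟩
    · have hpk := pow_pos hp k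
      refine (natDegree_sum_le_of_forall_le _ _ (n := p ^ (k + 1) - 1) fun b _ => ?_).trans_lt
        (Nat.sub_lt (pow_pos hp _) one_pos)
      refine natDegree_mul_le.trans ((add_le_add_right natDegree_pow_le _).trans ?_)
      have h1 := hM a b
      have h2 : p * (M' b c).natDegree ≤ p * (p ^ k - 1) :=
        Nat.mul_le_mul_left _ (Nat.le_sub_one_of_lt (hM' b c))
      rw [Nat.mul_sub, ← pow_succ', mul_one] at h2
      have h3 : p ≤ p ^ (k + 1) := Nat.le_self_pow (by omega) p
      omega
    · conv_lhs => rw [he a]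
      have h1 : ∀ b, e b ^ p = ∑ c, algebraMap K[X] S (M' b c) ^ p * e c ^ p ^ (k + 1) := by
        intro b
        conv_lhs => rw [he' b]
        rw [sum_pow_char]
        simp only [mul_pow, ← pow_mul, ← pow_succ]
      simp only [h1, map_sum, map_mul, map_pow, Finset.mul_sum, Finset.sum_mul]
      rw [Finset.sum_comm]
      simp only [mul_assoc]

/-- The `N + 1` powers `g^(p^i)` are combinations of the `N` elements `e_b^(p^N)`, so they are
linearly dependent over `K[X]`. -/
theorem exists_annihilating_of_frobenius_system {e : ι → S} {M : ι → ι → K[X]}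
    (hM : ∀ a b, (M a b).natDegree < p) (he : ∀ a, e a = ∑ b, algebraMap K[X] S (M a b) * e b ^ p)
    (c : ι → K) {g : S} (hg : g = ∑ a, algebraMap K[X] S (C (c a)) * e a) :
    ∃ P : K[X][X], P ≠ 0 ∧ P.natDegree ≤ p ^ Fintype.card ι ∧
      (∀ k, (P.coeff k).natDegree ≤ Fintype.card ι * p ^ Fintype.card ι) ∧ aeval g P = 0 := by
  have hp := (Fact.out : p.Prime)
  set N := Fintype.card ι with hN
  have h1 : ∀ i : Fin (N + 1), ∃ D : ι → K[X], (∀ b, (D b).natDegree < p ^ N) ∧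
      g ^ p ^ (i : ℕ) = ∑ b, algebraMap K[X] S (D b) * e b ^ p ^ N := by
    intro i
    have hi : N - i + i = N := Nat.sub_add_cancel (Nat.le_of_lt_succ i.2)
    -- After `N - i` iterations, raising to the power `p^i` lands on `e_b^(p^N)` for every `i`.
    obtain ⟨M', hM', he'⟩ := exists_iterate_frobenius_system hM he (N - i)
    refine ⟨fun b => ∑ a, (C (c a) * M' a b) ^ p ^ (i : ℕ), fun b => ?_, ?_⟩
    · refine (natDegree_sum_le_of_forall_le _ _ (n := p ^ N - 1) fun a _ => ?_).trans_lt
        (Nat.sub_lt (pow_pos hp.pos _) one_pos)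
      refine natDegree_pow_le.trans ?_
      have h2 : p ^ (i : ℕ) * (C (c a) * M' a b).natDegree ≤ p ^ (i : ℕ) * (p ^ (N - i) - 1) :=
        Nat.mul_le_mul_left _ ((natDegree_C_mul_le _ _).trans (Nat.le_sub_one_of_lt (hM' a b)))
      rw [Nat.mul_sub, mul_comm _ (p ^ (N - i)), ← pow_add, hi, mul_one] at h2
      have := pow_pos hp.pos (i : ℕ)
      omega
    · rw [hg, sum_pow_char_pow]
      simp only [mul_pow, map_sum, map_pow, map_mul, Finset.sum_mul]
      rw [Finset.sum_comm]
      refine Finset.sum_congr rfl fun a _ => ?_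
      conv_lhs => rw [he' a]
      rw [sum_pow_char_pow, Finset.mul_sum]
      refine Finset.sum_congr rfl fun b _ => ?_
      rw [mul_pow, ← pow_mul, ← pow_add, hi, mul_assoc]
  choose D hD hgD using h1
  obtain ⟨A, hA0, hA, hAD⟩ :=
    Polynomial.exists_natDegree_le_sum_mul_eq_zero hN.symm (pow_pos hp.pos N) D hD
  -- The exponents `p^i` are distinct, so the `A i` are the separate coefficients of the polynomial
  -- and it is nonzero.
  have hinj : ∀ i j : Fin (N + 1), p ^ (i : ℕ) = p ^ (j : ℕ) ↔ i = j := fun i j =>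
    (Nat.pow_right_injective hp.two_le).eq_iff.trans Fin.val_inj
  have hcoeff : ∀ k, (∑ i : Fin (N + 1), C (A i) * X ^ p ^ (i : ℕ)).coeff k =
      ∑ i : Fin (N + 1), if k = p ^ (i : ℕ) then A i else 0 := fun k => by simp [coeff_X_pow]
  refine ⟨∑ i : Fin (N + 1), C (A i) * X ^ p ^ (i : ℕ), fun h => hA0 (_root_.funext fun j => ?_), ?_, fun k => ?_, ?_⟩
  · have h2 := hcoeff (p ^ (j : ℕ))
    simpa [h, hinj] using h2.symm
  · refine natDegree_sum_le_of_forall_le _ _ fun i _ => (natDegree_C_mul_X_pow_le _ _).trans ?_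
    exact Nat.pow_le_pow_right hp.pos (Nat.le_of_lt_succ i.2)
  · rw [hcoeff]
    refine natDegree_sum_le_of_forall_le _ _ fun i _ => ?_
    split_ifs
    · exact hA i
    · simp
  · simp only [map_sum, map_mul, map_pow, aeval_C, aeval_X, hgD, Finset.mul_sum]
    rw [Finset.sum_comm]
    refine Finset.sum_eq_zero fun b _ => ?_
    simp only [← mul_assoc, ← map_mul]
    rw [← Finset.sum_mul, ← map_sum, hAD, map_zero, zero_mul]

end FrobeniusSystem

/-! ### p-th powers of Hahn series -/

namespace HahnSeries

section Restrict

variable {Γ K : Type*} [PartialOrder Γ] [Zero K]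

open Classical in
/-- The part of a Hahn series supported in a given set. -/
noncomputable def restrict (s : Set Γ) (u : HahnSeries Γ K) : HahnSeries Γ K where
  coeff δ := if δ ∈ s then u.coeff δ else 0
  isPWO_support' := u.isPWO_support.mono fun δ hδ h => hδ (by simp [h])

theorem mem_of_mem_support_restrict {s : Set Γ} {u : HahnSeries Γ K} {δ : Γ}
    (h : δ ∈ (restrict s u).support) : δ ∈ s := by
  by_contra hs
  exact h (if_neg hs)

end Restrict

section Frobenius

variable {Γ K : Type*} [AddCommGroup Γ] [LinearOrder Γ] [IsOrderedAddMonoid Γ] [Field K]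

theorem charP (Γ K : Type*) [AddCommGroup Γ] [LinearOrder Γ] [IsOrderedAddMonoid Γ] [Field K]
    (p : ℕ) [CharP K p] : CharP (HahnSeries Γ K) p :=
  charP_of_injective_ringHom (f := (C : K →+* HahnSeries Γ K)) C_injective p

theorem support_pow_succ_induction {u : HahnSeries Γ K} {M : ℕ → Γ → Prop}
    (h1 : ∀ δ ∈ u.support, M 1 δ) (hadd : ∀ k, ∀ ε, M k ε → ∀ δ ∈ u.support, M (k + 1) (ε + δ))
    (k : ℕ) : ∀ ε ∈ (u ^ (k + 1)).support, M (k + 1) ε := by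
  induction k with
  | zero => simpa using h1
  | succ k ih =>
    intro ε hε
    rw [pow_succ] at hε
    obtain ⟨a, ha, b, hb, rfl⟩ := support_mul_subset hε
    exact hadd _ _ (ih a ha) b hb

/-- By induction, every `ε` in the support of `u^k`, `k ≥ 1`, has `p • ε < k • γ`; for `k = p` this
excludes `ε = γ`. -/
theorem coeff_pow_eq_zero_of_nsmul_lt {u : HahnSeries Γ K} {p : ℕ} (hp : 0 < p) {γ : Γ}
    (h : ∀ δ ∈ u.support, p • δ < γ) : (u ^ p).coeff γ = 0 := by
  by_contra hne
  have h1 := support_pow_succ_induction (M := fun k ε => p • ε < k • γ) (u := u)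
    (by simpa using h) (fun k ε hε δ hδ => by
      rw [smul_add, succ_nsmul]
      exact add_lt_add hε (h δ hδ)) (p - 1) γ
  rw [Nat.sub_add_cancel hp] at h1
  exact lt_irrefl _ (h1 hne)

theorem coeff_pow_eq_zero_of_lt_nsmul {u : HahnSeries Γ K} {p : ℕ} (hp : 0 < p) {γ : Γ}
    (h : ∀ δ ∈ u.support, γ < p • δ) : (u ^ p).coeff γ = 0 := by
  by_contra hne
  have h1 := support_pow_succ_induction (M := fun k ε => k • γ < p • ε) (u := u)
    (by simpa using h) (fun k ε hε δ hδ => by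
      rw [smul_add, succ_nsmul]
      exact add_lt_add hε (h δ hδ)) (p - 1) γ
  rw [Nat.sub_add_cancel hp] at h1
  exact lt_irrefl _ (h1 hne)

variable {p : ℕ} [Fact p.Prime] [CharP K p]

/-- Split `u` according to whether `p • δ` is below, at or above `γ`. Frobenius is additive, and the
p-th powers of the outer parts have no term at `γ`. -/
theorem coeff_pow_char_eq (u : HahnSeries Γ K) (γ : Γ) :
    (u ^ p).coeff γ = ((restrict {δ | p • δ = γ} u) ^ p).coeff γ := by
  have hp := (Fact.out : p.Prime).pos
  have := charP Γ K p
  have h : u = restrict {δ | p • δ < γ} u + restrict {δ | p • δ = γ} u +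
      restrict {δ | γ < p • δ} u := by
    ext δ
    rcases lt_trichotomy (p • δ) γ with h | h | h
    · simp [restrict, h, h.ne, h.not_gt]
    · simp [restrict, h]
    · simp [restrict, h, h.ne', h.not_gt]
  conv_lhs => rw [h]
  rw [add_pow_char, add_pow_char, coeff_add, coeff_add,
    coeff_pow_eq_zero_of_nsmul_lt (u := restrict {δ | p • δ < γ} u) hp fun δ hδ =>
      mem_of_mem_support_restrict (s := {δ | p • δ < γ}) hδ,
    coeff_pow_eq_zero_of_lt_nsmul (u := restrict {δ | γ < p • δ} u) hp fun δ hδ =>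
      mem_of_mem_support_restrict (s := {δ | γ < p • δ}) hδ, zero_add, add_zero]

theorem coeff_pow_char_nsmul (u : HahnSeries Γ K) (δ : Γ) :
    (u ^ p).coeff (p • δ) = u.coeff δ ^ p := by
  have hp := (Fact.out : p.Prime).ne_zero
  have h : restrict {ε | p • ε = p • δ} u = single δ (u.coeff δ) := by
    ext ε
    by_cases hε : ε = δ
    · simp [restrict, hε]
    · rw [coeff_single_of_ne hε]
      exact if_neg fun h => hε (nsmul_right_injective hp h)
  rw [coeff_pow_char_eq, h, single_pow, coeff_single_same]

theorem coeff_pow_char_eq_zero (u : HahnSeries Γ K) {γ : Γ} (h : ∀ δ, p • δ ≠ γ) :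
    (u ^ p).coeff γ = 0 := by
  have h : restrict {ε | p • ε = γ} u = 0 := by
    ext ε
    exact if_neg (h ε)
  rw [coeff_pow_char_eq, h, zero_pow (Fact.out : p.Prime).ne_zero, coeff_zero]

/-- The hypothesis `hE` says that the `E r` are pairwise incongruent modulo `p • Γ`, so only the
summand `r₀` has terms in the class of `E r₀`. -/
theorem coeff_sum_single_mul_pow_char {ρ : Type*} [Fintype ρ] {E : ρ → Γ}
    (hE : ∀ r r' δ, E r - E r' = p • δ → r = r') (u : ρ → HahnSeries Γ K) (r₀ : ρ) (δ : Γ) :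
    (∑ r, single (E r) 1 * u r ^ p).coeff (E r₀ + p • δ) = (u r₀).coeff δ ^ p := by
  rw [coeff_sum, Finset.sum_eq_single r₀ _ (by simp)]
  · rw [coeff_single_mul, one_mul, add_sub_cancel_left, coeff_pow_char_nsmul]
  · intro r _ hr
    rw [coeff_single_mul, one_mul]
    refine coeff_pow_char_eq_zero _ fun ε hε => hr ?_
    refine (hE r₀ r (ε - δ) ?_).symm
    rw [smul_sub, hε]
    abel

end Frobenius

end HahnSeries

/-! ### Power series as Laurent series -/

/-- The inclusion of `ℕⁿ` into the ordered group of exponents. -/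
def LexExponent.ofNat (n : ℕ) : (Fin n →₀ ℕ) →+ LexExponent n where
  toFun m := toLex fun i => (m (OrderDual.ofDual i) : ℤ)
  map_zero' := rfl
  map_add' _ _ := congrArg toLex (_root_.funext fun _ => Int.natCast_add _ _)

theorem LexExponent.ofNat_injective (n : ℕ) : Function.Injective (LexExponent.ofNat n) := by
  intro m m' h
  ext i
  exact Int.ofNat_injective (congrFun (congrArg ofLex h) (OrderDual.toDual i))

/-- Dickson's lemma for `ℕⁿ`, carried along a monotone map. -/
theorem LexExponent.isPWO_range_ofNat (n : ℕ) : (Set.range (LexExponent.ofNat n)).IsPWO := by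
  rw [← Set.image_univ]
  refine Set.IsPWO.image_of_monotone ?_ ?_
  · exact Set.isPWO_of_wellQuasiOrderedLE _
  · intro m m' h
    exact Pi.toLex_monotone fun i => Int.ofNat_le.2 (h (OrderDual.ofDual i))

namespace MvLaurentSeries

variable {n : ℕ} {K : Type*} [Field K]

theorem algebraMap_monomial (m : Fin n →₀ ℕ) (a : K) :
    algebraMap (MvPolynomial (Fin n) K) (MvLaurentSeries n K) (MvPolynomial.monomial m a) =
      HahnSeries.single (LexExponent.ofNat n m) a := by
  have hC : ∀ a : K, algebraMap (MvPolynomial (Fin n) K) (MvLaurentSeries n K) (MvPolynomial.C a) =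
      HahnSeries.single 0 a := fun a => MvPolynomial.aeval_C _ a
  have hX : ∀ i : Fin n, algebraMap (MvPolynomial (Fin n) K) (MvLaurentSeries n K)
      (MvPolynomial.X i) = HahnSeries.single (LexExponent.ofNat n (Finsupp.single i 1)) 1 := by
    intro i
    refine (MvPolynomial.aeval_X _ i).trans ?_
    congr 2
    refine congrArg toLex (_root_.funext fun j => ?_)
    obtain ⟨j, rfl⟩ := OrderDual.toDual.surjective j
    rw [Pi.single_apply, OrderDual.ofDual_toDual, Finsupp.single_apply, Nat.cast_ite]
    simp [eq_comm]
  induction m using Finsupp.induction_linear generalizing a with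
  | zero => simpa using hC a
  | add m m' h h' =>
    rw [← mul_one a, ← MvPolynomial.monomial_mul, map_mul, h, h', HahnSeries.single_mul_single,
      map_add]
  | single i k =>
    rw [← MvPolynomial.C_mul_X_pow_eq_monomial, map_mul, map_pow, hC, hX, HahnSeries.single_pow,
      HahnSeries.single_mul_single, ← map_nsmul]
    simp

/-- The Laurent series with the coefficients of a given power series. -/
noncomputable def ofMvPowerSeriesFun (f : MvPowerSeries (Fin n) K) : MvLaurentSeries n K where
  coeff := Function.extend (LexExponent.ofNat n) (fun m => MvPowerSeries.coeff m f) 0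
  isPWO_support' := (LexExponent.isPWO_range_ofNat n).mono fun γ hγ => by
    by_contra h
    exact hγ (Function.extend_apply' _ _ _ h)

theorem coeff_ofMvPowerSeriesFun (f : MvPowerSeries (Fin n) K) (m : Fin n →₀ ℕ) :
    (ofMvPowerSeriesFun f).coeff (LexExponent.ofNat n m) = MvPowerSeries.coeff m f :=
  (LexExponent.ofNat_injective n).extend_apply _ _ _

theorem coeff_ofMvPowerSeriesFun_of_notMem (f : MvPowerSeries (Fin n) K) {γ : LexExponent n}
    (h : γ ∉ Set.range (LexExponent.ofNat n)) : (ofMvPowerSeriesFun f).coeff γ = 0 :=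
  Function.extend_apply' _ _ _ h

theorem mem_range_of_mem_support {f : MvPowerSeries (Fin n) K} {γ : LexExponent n}
    (h : γ ∈ (ofMvPowerSeriesFun f).support) : γ ∈ Set.range (LexExponent.ofNat n) := by
  by_contra h'
  exact h (coeff_ofMvPowerSeriesFun_of_notMem f h')

theorem ofMvPowerSeriesFun_monomial (m : Fin n →₀ ℕ) (a : K) :
    ofMvPowerSeriesFun (MvPowerSeries.monomial m a) =
      HahnSeries.single (LexExponent.ofNat n m) a := by
  classical
  ext γ
  by_cases h : γ ∈ Set.range (LexExponent.ofNat n)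
  · obtain ⟨m', rfl⟩ := h
    rw [coeff_ofMvPowerSeriesFun, MvPowerSeries.coeff_monomial, HahnSeries.coeff_single,
      (LexExponent.ofNat_injective n).eq_iff]
    congr
  · rw [coeff_ofMvPowerSeriesFun_of_notMem _ h, HahnSeries.coeff_single_of_ne]
    rintro rfl
    exact h ⟨m, rfl⟩

theorem ofMvPowerSeriesFun_add (f g : MvPowerSeries (Fin n) K) :
    ofMvPowerSeriesFun (f + g) = ofMvPowerSeriesFun f + ofMvPowerSeriesFun g := by
  ext γ
  by_cases h : γ ∈ Set.range (LexExponent.ofNat n)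
  · obtain ⟨m, rfl⟩ := h
    simp [coeff_ofMvPowerSeriesFun]
  · simp [coeff_ofMvPowerSeriesFun_of_notMem _ h]

theorem ofMvPowerSeriesFun_mul (f g : MvPowerSeries (Fin n) K) :
    ofMvPowerSeriesFun (f * g) = ofMvPowerSeriesFun f * ofMvPowerSeriesFun g := by
  classical
  ext γ
  rw [HahnSeries.coeff_mul]
  by_cases h : γ ∈ Set.range (LexExponent.ofNat n)
  · obtain ⟨m, rfl⟩ := h
    let E : (Fin n →₀ ℕ) × (Fin n →₀ ℕ) ↪ LexExponent n × LexExponent n :=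
      ⟨Prod.map (LexExponent.ofNat n) (LexExponent.ofNat n),
        (LexExponent.ofNat_injective n).prodMap (LexExponent.ofNat_injective n)⟩
    rw [coeff_ofMvPowerSeriesFun, MvPowerSeries.coeff_mul]
    trans ∑ ij ∈ (Finset.HasAntidiagonal.antidiagonal m).map E,
      (ofMvPowerSeriesFun f).coeff ij.1 * (ofMvPowerSeriesFun g).coeff ij.2
    · rw [Finset.sum_map]
      exact Finset.sum_congr rfl fun ij _ => by
        simp only [E, Function.Embedding.coeFn_mk, Prod.map_fst, Prod.map_snd,
          coeff_ofMvPowerSeriesFun]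
    · symm
      -- The Hahn antidiagonal runs over the supports only; the other pairs summing to `m` have a
      -- zero factor.
      refine Finset.sum_subset ?_ ?_
      · rintro ⟨a, b⟩ hab
        simp only [Finset.mem_antidiagonal] at hab
        obtain ⟨ha, hb, hab⟩ := hab
        obtain ⟨a, rfl⟩ := mem_range_of_mem_support ha
        obtain ⟨b, rfl⟩ := mem_range_of_mem_support hb
        rw [← map_add] at hab
        exact Finset.mem_map.2 ⟨(a, b), Finset.HasAntidiagonal.mem_antidiagonal.2
          (LexExponent.ofNat_injective n hab), rfl⟩
      · intro x hx hx'
        obtain ⟨⟨a, b⟩, hab, rfl⟩ := Finset.mem_map.1 hx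
        by_contra hne
        refine hx' ?_
        simp only [Finset.mem_antidiagonal]
        refine ⟨left_ne_zero_of_mul hne, right_ne_zero_of_mul hne, ?_⟩
        rw [← Finset.HasAntidiagonal.mem_antidiagonal.1 hab, map_add]
        rfl
  · rw [coeff_ofMvPowerSeriesFun_of_notMem _ h]
    refine (Finset.sum_eq_zero fun x hx => ?_).symm
    simp only [Finset.mem_antidiagonal] at hx
    obtain ⟨ha, hb, hab⟩ := hx
    obtain ⟨a, ha⟩ := mem_range_of_mem_support ha
    obtain ⟨b, hb⟩ := mem_range_of_mem_support hb
    exact absurd ⟨a + b, by rw [map_add, ha, hb, hab]⟩ h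

/-- The inclusion of power series into multivariate Laurent series. -/
noncomputable def ofMvPowerSeries (n : ℕ) (K : Type*) [Field K] :
    MvPowerSeries (Fin n) K →+* MvLaurentSeries n K where
  toFun := ofMvPowerSeriesFun
  map_one' := ofMvPowerSeriesFun_monomial 0 1
  map_mul' := ofMvPowerSeriesFun_mul
  map_zero' := by simpa using ofMvPowerSeriesFun_monomial (n := n) (K := K) 0 0
  map_add' := ofMvPowerSeriesFun_add

theorem ofMvPowerSeries_injective : Function.Injective (ofMvPowerSeries n K) := by
  intro f g h
  ext m
  rw [← coeff_ofMvPowerSeriesFun, ← coeff_ofMvPowerSeriesFun]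
  exact congrArg (fun u => HahnSeries.coeff u _) h

theorem ofMvPowerSeries_algebraMap (P : MvPolynomial (Fin n) K) :
    ofMvPowerSeries n K (algebraMap (MvPolynomial (Fin n) K) (MvPowerSeries (Fin n) K) P) =
      algebraMap (MvPolynomial (Fin n) K) (MvLaurentSeries n K) P := by
  induction P using MvPolynomial.induction_on' with
  | monomial m a =>
    rw [algebraMap_monomial, MvPowerSeries.algebraMap_apply', MvPolynomial.coe_monomial,
      Algebra.algebraMap_self, MvPowerSeries.map_id, RingHom.id_apply]
    exact ofMvPowerSeriesFun_monomial m a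
  | add P Q hP hQ => rw [map_add, map_add, map_add, hP, hQ]

instance : FaithfulSMul (MvPolynomial (Fin n) K) (MvLaurentSeries n K) := by
  refine (faithfulSMul_iff_algebraMap_injective _ _).2 fun P Q h => ?_
  rw [← ofMvPowerSeries_algebraMap, ← ofMvPowerSeries_algebraMap] at h
  have h1 := ofMvPowerSeries_injective h
  rw [MvPowerSeries.algebraMap_apply', MvPowerSeries.algebraMap_apply', Algebra.algebraMap_self,
    MvPowerSeries.map_id] at h1
  exact MvPolynomial.coe_injective _ _ h1

end MvLaurentSeries

/-! ### The diagonal and the Cartier decomposition -/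

theorem Fin.eq_of_cast_sub_eq_mul {p : ℕ} {a b : Fin p} {c : ℤ} (h : (a : ℤ) - b = p * c) :
    a = b := by
  have h1 := Int.eq_zero_of_abs_lt_dvd (m := p) ⟨c, h⟩ (by rw [abs_lt]; omega)
  exact Fin.ext (by omega)

theorem LexExponent.eq_of_ofNat_sub_eq_nsmul {n p : ℕ} (r r' : Fin n → Fin p) (δ : LexExponent n)
    (h : LexExponent.ofNat n (Finsupp.equivFunOnFinite.symm fun i => (r i : ℕ)) -
      LexExponent.ofNat n (Finsupp.equivFunOnFinite.symm fun i => (r' i : ℕ)) = p • δ) :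
    r = r' := by
  refine _root_.funext fun i => Fin.eq_of_cast_sub_eq_mul (c := ofLex δ (OrderDual.toDual i)) ?_
  exact (congrFun (congrArg ofLex h) (OrderDual.toDual i)).trans (nsmul_eq_mul p _)

section Diagonal

variable {n : ℕ} {K : Type*} [Field K] {p : ℕ} [Fact p.Prime] [CharP K p]

theorem MvLaurentSeries.eq_zero_of_sum_monomial_mul_pow_eq_zero
    (u : (Fin n → Fin p) → MvLaurentSeries n K)
    (h : ∑ r : Fin n → Fin p, algebraMap (MvPolynomial (Fin n) K) (MvLaurentSeries n K)
      (MvPolynomial.monomial (Finsupp.equivFunOnFinite.symm fun i => (r i : ℕ)) 1) * u r ^ p = 0)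
    (r : Fin n → Fin p) : u r = 0 := by
  ext δ
  simp only [algebraMap_monomial] at h
  have h1 := HahnSeries.coeff_sum_single_mul_pow_char
    LexExponent.eq_of_ofNat_sub_eq_nsmul u r δ
  rw [h, HahnSeries.coeff_zero] at h1
  exact pow_eq_zero_iff (Fact.out : p.Prime).ne_zero |>.1 h1.symm

variable [NeZero n]

/-- The diagonal as an additive map. -/
noncomputable def diagLaurentHom (n : ℕ) [NeZero n] (K : Type*) [Field K] :
    MvLaurentSeries n K →+ LaurentSeries K where
  toFun := diagLaurentSeries
  map_zero' := rfl
  map_add' _ _ := rfl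

theorem diagLaurentHom_C_mul (a : K) (u : MvLaurentSeries n K) :
    diagLaurentHom n K (algebraMap (MvPolynomial (Fin n) K) (MvLaurentSeries n K)
      (MvPolynomial.C a) * u) = algebraMap K[X] (LaurentSeries K) (C a) * diagLaurentHom n K u := by
  have h1 : algebraMap (MvPolynomial (Fin n) K) (MvLaurentSeries n K) (MvPolynomial.C a) =
      HahnSeries.C a := MvPolynomial.aeval_C _ a
  have h2 : algebraMap K[X] (LaurentSeries K) (C a) = HahnSeries.C a := by
    rw [Polynomial.algebraMap_hahnSeries_apply, coe_C, HahnSeries.ofPowerSeries_C]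
  rw [h1, h2, HahnSeries.C_mul_eq_smul, HahnSeries.C_mul_eq_smul]
  rfl

/-- A diagonal exponent `(k, …, k)` with `k = j + p q` has residue vector `(j, …, j)`, so only
constant `r` contribute. Both sides have the coefficient of `u_(j,…,j)` at `(q, …, q)`, raised to
the power `p`. -/
theorem diagLaurentHom_sum_monomial_mul_pow (u : (Fin n → Fin p) → MvLaurentSeries n K) :
    diagLaurentHom n K (∑ r : Fin n → Fin p,
      algebraMap (MvPolynomial (Fin n) K) (MvLaurentSeries n K)
        (MvPolynomial.monomial (Finsupp.equivFunOnFinite.symm fun i => (r i : ℕ)) 1) * u r ^ p) =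
      ∑ j : Fin p, algebraMap K[X] (LaurentSeries K) (X ^ (j : ℕ)) *
        diagLaurentHom n K (u fun _ => j) ^ p := by
  have hp := (Fact.out : p.Prime).pos
  have hX : ∀ j : ℕ, algebraMap K[X] (LaurentSeries K) (X ^ j) = HahnSeries.single (j : ℤ) 1 := by
    intro j
    rw [Polynomial.algebraMap_hahnSeries_apply, coe_pow, coe_X, HahnSeries.ofPowerSeries_X_pow]
  simp only [MvLaurentSeries.algebraMap_monomial, hX]
  ext k
  obtain ⟨j, q, rfl⟩ : ∃ (j : Fin p) (q : ℤ), k = j + p • q := by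
    have h0 := Int.emod_nonneg k (show (p : ℤ) ≠ 0 by omega)
    have h1 := Int.emod_lt_of_pos k (show (0 : ℤ) < p by omega)
    refine ⟨⟨(k % p).toNat, by omega⟩, k / p, ?_⟩
    rw [nsmul_eq_mul, Int.toNat_of_nonneg h0, Int.emod_add_mul_ediv]
  rw [HahnSeries.coeff_sum_single_mul_pow_char (E := fun j : Fin p => ((j : ℕ) : ℤ))
    fun r r' δ h => Fin.eq_of_cast_sub_eq_mul (c := δ) (by rw [h, nsmul_eq_mul])]
  exact HahnSeries.coeff_sum_single_mul_pow_char LexExponent.eq_of_ofNat_sub_eq_nsmul u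
    (fun _ => j) (toLex fun _ => q)

theorem exists_annihilating_diagLaurentSeries_of_perfect [PerfectRing K p] {d h : ℕ}
    {f : MvLaurentSeries n K} {P Q : (MvPolynomial (Fin n) K)[X]} (hP : P ≠ 0)
    (hPd : P.natDegree ≤ d) (hPf : aeval f P = 0) (hQ : Q ≠ 0)
    (hQh : ∀ k, (Q.coeff k).totalDegree ≤ h) (hQf : aeval f Q = 0) :
    ∃ T : K[X][X], T ≠ 0 ∧ T.natDegree ≤ p ^ ((d + 1) * (h + 1) ^ n) ∧
      (∀ k, (T.coeff k).natDegree ≤ (d + 1) * (h + 1) ^ n * p ^ ((d + 1) * (h + 1) ^ n)) ∧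
      aeval (diagLaurentSeries f) T = 0 := by
  have hp := (Fact.out : p.Prime)
  -- `P` controls only the degree and `Q` only the height; `M` inherits both bounds, the first by
  -- minimality and the second as a divisor of `Q`.
  obtain ⟨M, hMQ, hM, hMf, hmin⟩ := exists_dvd_aeval_eq_zero_natDegree_minimal hQ hQf
  have hMd : M.natDegree ≤ d := (hmin P hP hPf).trans hPd
  have hMh : ∀ k i, (M.coeff k).degreeOf i ≤ h := fun k i =>
    MvPolynomial.degreeOf_coeff_le_of_dvd hQ hMQ
      (fun k => (MvPolynomial.degreeOf_le_totalDegree _ _).trans (hQh k)) k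
  have hM' := aeval_derivative_ne_zero_of_minimal (p := p) hM hMf hmin
    MvLaurentSeries.eq_zero_of_sum_monomial_mul_pow_eq_zero
  choose c hc using exists_boxMonomial_div_eq_sum_pow (p := p) hMd hMh hMf hM'
  obtain ⟨c₀, hc₀⟩ := exists_eq_sum_boxMonomial_div hMd hMh hM'
  have := HahnSeries.charP ℤ K p
  have hcard : Fintype.card (Fin (d + 1) × (Fin n → Fin (h + 1))) = (d + 1) * (h + 1) ^ n := by
    simp
  rw [← hcard]
  refine exists_annihilating_of_frobenius_system (p := p)
    (e := fun a => diagLaurentHom n K (aeval f (boxMonomial K a) / aeval f (derivative M)))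
    (M := fun a b => ∑ j : Fin p, X ^ (j : ℕ) * C (c a (fun _ => j) b) ^ p)
    (fun a b => ?_) (fun a => ?_) c₀ ?_
  · refine (natDegree_sum_le_of_forall_le _ _ (n := p - 1) fun j _ => ?_).trans_lt
      (Nat.sub_lt hp.pos one_pos)
    rw [← C_pow]
    exact (natDegree_mul_C_le _ _).trans ((natDegree_X_pow_le _).trans (Nat.le_sub_one_of_lt j.2))
  · conv_lhs => rw [hc a, diagLaurentHom_sum_monomial_mul_pow]
    simp only [map_sum, diagLaurentHom_C_mul, sum_pow_char, mul_pow, map_mul, map_pow,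
      Finset.mul_sum, Finset.sum_mul]
    rw [Finset.sum_comm]
    simp only [mul_assoc]
  · change diagLaurentHom n K f = _
    conv_lhs => rw [hc₀]
    simp only [map_sum, diagLaurentHom_C_mul]

end Diagonal

/-! ### Extension of scalars and descent -/

section BaseChange

variable {Γ K L : Type*} [AddCommGroup Γ] [LinearOrder Γ] [IsOrderedAddMonoid Γ] [Field K] [Field L]

/-- The ring homomorphism of Hahn series induced by one of the coefficients. -/
noncomputable def HahnSeries.mapRingHom (Γ : Type*) [AddCommGroup Γ] [LinearOrder Γ]
    [IsOrderedAddMonoid Γ] (φ : K →+* L) : HahnSeries Γ K →+* HahnSeries Γ L where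
  toFun u := u.map φ
  map_one' := HahnSeries.map_one φ.toMonoidWithZeroHom
  map_mul' _ _ := HahnSeries.map_mul (φ : K →ₙ+* L)
  map_zero' := by
    ext
    simp
  map_add' _ _ := by
    ext
    simp

theorem MvLaurentSeries.mapRingHom_algebraMap {n : ℕ} (φ : K →+* L)
    (P : MvPolynomial (Fin n) K) :
    HahnSeries.mapRingHom (LexExponent n) φ
        (algebraMap (MvPolynomial (Fin n) K) (MvLaurentSeries n K) P) =
      algebraMap (MvPolynomial (Fin n) L) (MvLaurentSeries n L) (MvPolynomial.map φ P) := by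
  induction P using MvPolynomial.induction_on' with
  | monomial m a =>
    rw [algebraMap_monomial, MvPolynomial.map_monomial, algebraMap_monomial]
    exact HahnSeries.map_single φ.toMonoidWithZeroHom.toZeroHom
  | add P Q hP hQ => simp only [map_add, hP, hQ]

theorem Polynomial.aeval_map_ringHom_eq {A B S S' : Type*} [CommRing A] [CommRing B] [CommRing S]
    [CommRing S'] [Algebra A S] [Algebra B S'] {ψ : A →+* B} {θ : S →+* S'}
    (h : ∀ a, θ (algebraMap A S a) = algebraMap B S' (ψ a)) (f : S) (P : A[X]) :
    aeval (θ f) (P.map ψ) = θ (aeval f P) := by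
  rw [aeval_def, aeval_def, eval₂_map, hom_eval₂,
    show θ.comp (algebraMap A S) = (algebraMap B S').comp ψ from RingHom.ext h]

theorem LaurentSeries.algebraMap_monomial (j : ℕ) (a : K) :
    algebraMap K[X] (LaurentSeries K) (monomial j a) = HahnSeries.single (j : ℤ) a := by
  rw [Polynomial.algebraMap_hahnSeries_apply, ← C_mul_X_pow_eq_monomial, coe_mul, coe_pow, coe_X,
    coe_C, map_mul, HahnSeries.ofPowerSeries_C, HahnSeries.ofPowerSeries_X_pow,
    HahnSeries.C_apply,
    HahnSeries.single_mul_single, zero_add, mul_one]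

/-- A `K`-linear functional on `L`, applied to all coefficients of `T`, preserves the relation
because the powers of `g` have coefficients in `K`. It does not raise degrees, and it is chosen not
to kill one nonzero coefficient. -/
theorem LaurentSeries.exists_annihilating_of_map [Algebra K L] {g : LaurentSeries K} {T : L[X][X]}
    {s D : ℕ} (hT : T ≠ 0) (hs : T.natDegree ≤ s) (hD : ∀ k, (T.coeff k).natDegree ≤ D)
    (hg : aeval (R := L[X]) (A := LaurentSeries L)
      (HahnSeries.mapRingHom ℤ (algebraMap K L) g) T = 0) :
    ∃ T' : K[X][X], T' ≠ 0 ∧ T'.natDegree ≤ s ∧ (∀ k, (T'.coeff k).natDegree ≤ D) ∧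
      aeval g T' = 0 := by
  obtain ⟨k₀, hk₀⟩ : ∃ k, T.coeff k ≠ 0 := by
    by_contra! h
    exact hT (ext h)
  obtain ⟨j₀, hj₀⟩ : ∃ j, (T.coeff k₀).coeff j ≠ 0 := by
    by_contra! h
    exact hk₀ (ext h)
  obtain ⟨φ, hφ⟩ : ∃ φ : Module.Dual K L, φ ((T.coeff k₀).coeff j₀) ≠ 0 := by
    by_contra! h
    exact hj₀ ((Module.forall_dual_apply_eq_zero_iff K _).1 h)
  have hks : k₀ < s + 1 := Nat.lt_succ_of_le ((le_natDegree_of_ne_zero hk₀).trans hs)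
  have hjD : j₀ < D + 1 := Nat.lt_succ_of_le ((le_natDegree_of_ne_zero hj₀).trans (hD k₀))
  have hcoeff : ∀ k, (∑ k ∈ Finset.range (s + 1), monomial k (∑ j ∈ Finset.range (D + 1),
      monomial j (φ ((T.coeff k).coeff j)))).coeff k = if k < s + 1 then
        ∑ j ∈ Finset.range (D + 1), monomial j (φ ((T.coeff k).coeff j)) else 0 := by
    intro k
    simp [coeff_monomial]
  refine ⟨∑ k ∈ Finset.range (s + 1), monomial k (∑ j ∈ Finset.range (D + 1),
    monomial j (φ ((T.coeff k).coeff j))), fun h => ?_, ?_, fun k => ?_, ?_⟩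
  · have h1 := hcoeff k₀
    rw [h, coeff_zero, if_pos hks] at h1
    have h2 := congrArg (coeff · j₀) h1
    simp only [coeff_zero, finsetSum_coeff, coeff_monomial, Finset.sum_ite_eq', Finset.mem_range,
      if_pos hjD] at h2
    exact hφ h2.symm
  · exact natDegree_sum_le_of_forall_le _ _ fun k hk =>
      (natDegree_monomial_le _).trans (Nat.le_of_lt_succ (Finset.mem_range.1 hk))
  · rw [hcoeff]
    split_ifs
    · exact natDegree_sum_le_of_forall_le _ _ fun j hj =>
        (natDegree_monomial_le _).trans (Nat.le_of_lt_succ (Finset.mem_range.1 hj))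
    · simp
  · have hTsum : T = ∑ k ∈ Finset.range (s + 1), monomial k (∑ j ∈ Finset.range (D + 1),
        monomial j ((T.coeff k).coeff j)) := by
      conv_lhs => rw [T.as_sum_range' (s + 1) (Nat.lt_succ_of_le hs)]
      exact Finset.sum_congr rfl fun k _ => congrArg _
        ((T.coeff k).as_sum_range' (D + 1) (Nat.lt_succ_of_le (hD k)))
    rw [hTsum] at hg
    simp only [map_sum, aeval_monomial, algebraMap_monomial, ← map_pow] at hg ⊢
    ext z
    have h1 := congrArg (fun u => φ (HahnSeries.coeff u z)) hg
    simp only [HahnSeries.coeff_sum, HahnSeries.coeff_single_mul, HahnSeries.coeff_zero, map_sum,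
      map_zero] at h1 ⊢
    rw [← h1]
    refine Finset.sum_congr rfl fun k _ => Finset.sum_congr rfl fun j _ => ?_
    change _ = φ (_ * algebraMap K L _)
    rw [mul_comm _ (algebraMap K L _), ← Algebra.smul_def, map_smul, smul_eq_mul, mul_comm]

end BaseChange

theorem exists_annihilating_diagLaurentSeries_of_algebra_perfect {K L : Type*} [Field K] [Field L]
    [Algebra K L] {p : ℕ} [Fact p.Prime] [CharP L p] [PerfectRing L p] {n : ℕ} [NeZero n] {d h : ℕ}
    {f : MvLaurentSeries n K} {P Q : (MvPolynomial (Fin n) K)[X]} (hP : P ≠ 0)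
    (hPd : P.natDegree ≤ d) (hPf : aeval f P = 0) (hQ : Q ≠ 0)
    (hQh : ∀ k, (Q.coeff k).totalDegree ≤ h) (hQf : aeval f Q = 0) :
    ∃ T : K[X][X], T ≠ 0 ∧ T.natDegree ≤ p ^ ((d + 1) * (h + 1) ^ n) ∧
      (∀ k, (T.coeff k).natDegree ≤ (d + 1) * (h + 1) ^ n * p ^ ((d + 1) * (h + 1) ^ n)) ∧
      aeval (diagLaurentSeries f) T = 0 := by
  let φ := algebraMap K L
  have hinj : Function.Injective (MvPolynomial.map (σ := Fin n) φ) :=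
    MvPolynomial.map_injective _ φ.injective
  have hmap : ∀ P : (MvPolynomial (Fin n) K)[X], aeval f P = 0 →
      aeval (HahnSeries.mapRingHom (LexExponent n) φ f) (P.map (MvPolynomial.map φ)) = 0 := by
    intro P hP
    rw [aeval_map_ringHom_eq (MvLaurentSeries.mapRingHom_algebraMap φ), hP, map_zero]
  have hQh' : ∀ k, ((Q.map (MvPolynomial.map φ)).coeff k).totalDegree ≤ h := by
    intro k
    rw [coeff_map]
    exact (Finset.sup_mono (MvPolynomial.support_map_subset φ (Q.coeff k))).trans (hQh k)
  obtain ⟨T, hT, hTd, hTh, hTf⟩ := exists_annihilating_diagLaurentSeries_of_perfect (p := p)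
    (h := h) ((Polynomial.map_ne_zero_iff hinj).2 hP) (natDegree_map_le.trans hPd) (hmap P hPf)
    ((Polynomial.map_ne_zero_iff hinj).2 hQ)
    hQh'
    (hmap Q hQf)
  have hdiag : diagLaurentSeries (HahnSeries.mapRingHom (LexExponent n) φ f) =
      HahnSeries.mapRingHom ℤ φ (diagLaurentSeries f) := rfl
  rw [hdiag] at hTf
  exact LaurentSeries.exists_annihilating_of_map (L := L) hT hTd hTh hTf

theorem exists_annihilating_diagLaurentSeries {K : Type*} [Field K] {p : ℕ} [Fact p.Prime]
    [CharP K p] {n : ℕ} [NeZero n] {d h : ℕ} {f : MvLaurentSeries n K}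
    {P Q : (MvPolynomial (Fin n) K)[X]} (hP : P ≠ 0)
    (hPd : P.natDegree ≤ d) (hPf : aeval f P = 0) (hQ : Q ≠ 0)
    (hQh : ∀ k, (Q.coeff k).totalDegree ≤ h) (hQf : aeval f Q = 0) :
    ∃ T : K[X][X], T ≠ 0 ∧ T.natDegree ≤ p ^ ((d + 1) * (h + 1) ^ n) ∧
      (∀ k, (T.coeff k).natDegree ≤ (d + 1) * (h + 1) ^ n * p ^ ((d + 1) * (h + 1) ^ n)) ∧
      aeval (diagLaurentSeries f) T = 0 := by
  have : CharP (AlgebraicClosure K) p :=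
    charP_of_injective_algebraMap (algebraMap K (AlgebraicClosure K)).injective p
  have : PerfectRing (AlgebraicClosure K) p := PerfectField.toPerfectRing p
  exact exists_annihilating_diagLaurentSeries_of_algebra_perfect (L := AlgebraicClosure K)
    hP hPd hPf hQ hQh hQf

/-! ### Degree, height and the main theorem -/

theorem algDegree_le {R S : Type*} [CommRing R] [CommRing S] [Algebra R S] {f : S} {P : R[X]}
    {m : ℕ} (hm : 0 < m) (hP : P ≠ 0) (hd : P.natDegree ≤ m) (hf : aeval f P = 0) :
    algDegree R f ≤ m :=
  Nat.sInf_le ⟨hm, P, hP, hd, hf⟩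

theorem algHeight_le {R S : Type*} [CommRing R] [CommRing S] [Algebra R S] {deg : R → ℕ} {f : S}
    {P : R[X]} {H : ℕ} (hP : P ≠ 0) (hh : ∀ k, deg (P.coeff k) ≤ H) (hf : aeval f P = 0) :
    algHeight deg f ≤ H :=
  (Nat.sInf_le (s := {H : ℕ | ∃ P : R[X], P ≠ 0 ∧ aeval f P = 0 ∧ coeffHeight deg P = H})
    ⟨P, hP, hf, rfl⟩).trans (Finset.sup_le fun k _ => hh k)

theorem exists_natDegree_le_of_algDegree_le {R S : Type*} [CommRing R] [CommRing S] [Algebra R S]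
    {f : S} {d : ℕ} (hf : IsAlgebraic R f) (hd : algDegree R f ≤ d) :
    ∃ P : R[X], P ≠ 0 ∧ P.natDegree ≤ d ∧ aeval f P = 0 := by
  obtain ⟨P, hP, hPf⟩ := hf
  -- Algebraicity makes the set nonempty, which excludes the default value `0` of `sInf`; the
  -- witness `natDegree + 1` is positive even for a constant `P`.
  obtain ⟨-, P', h1, h2, h3⟩ := Nat.sInf_mem (s := {m : ℕ | 0 < m ∧ ∃ P : R[X], P ≠ 0 ∧
    P.natDegree ≤ m ∧ aeval f P = 0}) ⟨P.natDegree + 1, Nat.succ_pos _, P, hP, Nat.le_succ _, hPf⟩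
  exact ⟨P', h1, h2.trans hd, h3⟩

theorem exists_coeff_le_of_algHeight_le {R S : Type*} [CommRing R] [CommRing S] [Algebra R S]
    {deg : R → ℕ} (h0 : deg 0 = 0) {f : S} {H : ℕ} (hf : IsAlgebraic R f)
    (hH : algHeight deg f ≤ H) :
    ∃ P : R[X], P ≠ 0 ∧ (∀ k, deg (P.coeff k) ≤ H) ∧ aeval f P = 0 := by
  obtain ⟨P, hP, hPf⟩ := hf
  obtain ⟨P', h1, h2, h3⟩ := Nat.sInf_mem (s := {H : ℕ | ∃ P : R[X], P ≠ 0 ∧ aeval f P = 0 ∧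
    coeffHeight deg P = H}) ⟨_, P, hP, hPf, rfl⟩
  refine ⟨P', h1, fun k => ?_, h2⟩
  by_cases hk : k ∈ P'.support
  · exact (Finset.le_sup (f := fun k => deg (P'.coeff k)) hk).trans (h3.le.trans hH)
  · rw [notMem_support_iff.1 hk, h0]
    exact Nat.zero_le _

theorem isAlgebraic_and_degree_height_le {K S : Type*} [Field K] [CommRing S] [Algebra K[X] S]
    {g : S} {p N : ℕ} (hp : 0 < p)
    (h : ∃ T : K[X][X], T ≠ 0 ∧ T.natDegree ≤ p ^ N ∧ (∀ k, (T.coeff k).natDegree ≤ N * p ^ N) ∧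
      aeval g T = 0) :
    IsAlgebraic K[X] g ∧ algDegree K[X] g ≤ p ^ N ∧
      algHeight (Polynomial.natDegree (R := K)) g ≤ N ^ 2 * p ^ (N + 1) := by
  obtain ⟨T, hT, hTd, hTh, hTg⟩ := h
  refine ⟨⟨T, hT, hTg⟩, algDegree_le (pow_pos hp _) hT hTd hTg,
    (algHeight_le hT hTh hTg).trans ?_⟩
  -- The bound obtained is `N p^N`; the stated `N^2 p^(N+1)` is weaker.
  exact Nat.mul_le_mul (Nat.le_self_pow two_ne_zero N) (Nat.pow_le_pow_right hp (Nat.le_succ N))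

theorem diagLaurentSeries_ofMvPowerSeries {n : ℕ} [NeZero n] {K : Type*} [Field K]
    (f : MvPowerSeries (Fin n) K) : diagLaurentSeries (MvLaurentSeries.ofMvPowerSeries n K f) =
      HahnSeries.ofPowerSeries ℤ K (diagPowerSeries f) := by
  ext k
  refine Eq.trans ?_ (PowerSeries.coeff_coe _ k).symm
  split_ifs with hk
  · refine MvLaurentSeries.coeff_ofMvPowerSeriesFun_of_notMem f ?_
    rintro ⟨m, hm⟩
    -- A coordinate exists because `n ≥ 1`, and it is natural, whereas `k` is negative.
    have h1 : ((m 0 : ℕ) : ℤ) = k := congrFun (congrArg ofLex hm) (OrderDual.toDual 0)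
    omega
  · obtain ⟨k, rfl⟩ := Int.eq_ofNat_of_zero_le (not_lt.1 hk)
    rw [Int.natAbs_natCast, diagPowerSeries, PowerSeries.coeff_mk]
    exact MvLaurentSeries.coeff_ofMvPowerSeriesFun f (Finsupp.equivFunOnFinite.symm fun _ => k)

theorem mainTheorem1 :
    ∃ A : ℕ → ℕ → ℕ → ℕ,
      Computable (fun t : ℕ × ℕ × ℕ => A t.1 t.2.1 t.2.2) ∧
      ∀ (K : Type*) [Field K] (p : ℕ) [CharP K p] (_ : 0 < p) (n : ℕ) [NeZero n] (d h : ℕ),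
        (∀ f : MvPowerSeries (Fin n) K,
          IsAlgebraic (MvPolynomial (Fin n) K) f →
          algDegree (MvPolynomial (Fin n) K) f ≤ d →
          algHeight (MvPolynomial.totalDegree (R := K) (σ := Fin n)) f ≤ h →
            IsAlgebraic K[X] (diagPowerSeries f) ∧
            algDegree K[X] (diagPowerSeries f) ≤ p ^ A n d h ∧
            algHeight (Polynomial.natDegree (R := K)) (diagPowerSeries f) ≤
              A n d h ^ 2 * p ^ (A n d h + 1)) ∧
        (∀ f : MvLaurentSeries n K,
          IsAlgebraic (MvPolynomial (Fin n) K) f →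
          algDegree (MvPolynomial (Fin n) K) f ≤ d →
          algHeight (MvPolynomial.totalDegree (R := K) (σ := Fin n)) f ≤ h →
            IsAlgebraic K[X] (diagLaurentSeries f) ∧
            algDegree K[X] (diagLaurentSeries f) ≤ p ^ A n d h ∧
            algHeight (Polynomial.natDegree (R := K)) (diagLaurentSeries f) ≤
              A n d h ^ 2 * p ^ (A n d h + 1)) := by
  refine ⟨fun n d h => (d + 1) * (h + 1) ^ n, ?_, ?_⟩
  · have hpow : Primrec₂ ((· ^ ·) : ℕ → ℕ → ℕ) := Primrec₂.unpaired'.1 Nat.Primrec.pow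
    exact (Primrec.nat_mul.comp (Primrec.succ.comp (Primrec.fst.comp Primrec.snd))
      (hpow.comp (Primrec.succ.comp (Primrec.snd.comp Primrec.snd)) Primrec.fst)).to_comp
  · intro K _ p _ hp n _ d h
    have : Fact p.Prime := ⟨(CharP.char_is_prime_or_zero K p).resolve_right hp.ne'⟩
    refine ⟨fun f hf hd hh => ?_, fun f hf hd hh => ?_⟩
    · obtain ⟨P, hP, hPd, hPf⟩ := exists_natDegree_le_of_algDegree_le hf hd
      obtain ⟨Q, hQ, hQh, hQf⟩ :=
        exists_coeff_le_of_algHeight_le MvPolynomial.totalDegree_zero hf hh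
      refine isAlgebraic_and_degree_height_le hp ?_
      have hmap : ∀ P : (MvPolynomial (Fin n) K)[X], aeval f P = 0 →
          aeval (MvLaurentSeries.ofMvPowerSeries n K f) P = 0 := by
        intro P hP
        have h1 := aeval_map_ringHom_eq (ψ := RingHom.id _)
          (θ := MvLaurentSeries.ofMvPowerSeries n K) MvLaurentSeries.ofMvPowerSeries_algebraMap f P
        rwa [hP, map_zero, Polynomial.map_id] at h1
      obtain ⟨T, hT, hTd, hTh, hTf⟩ := exists_annihilating_diagLaurentSeries (p := p) hP hPd
        (hmap P hPf) hQ hQh (hmap Q hQf)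
      refine ⟨T, hT, hTd, hTh, HahnSeries.ofPowerSeries_injective (Γ := ℤ) ?_⟩
      rw [diagLaurentSeries_ofMvPowerSeries] at hTf
      have h1 := aeval_map_ringHom_eq (A := K[X]) (ψ := RingHom.id K[X])
        (θ := HahnSeries.ofPowerSeries ℤ K) (fun _ => rfl) (diagPowerSeries f) T
      rw [Polynomial.map_id] at h1
      rw [← h1, map_zero]
      exact hTf
    · obtain ⟨P, hP, hPd, hPf⟩ := exists_natDegree_le_of_algDegree_le hf hd
      obtain ⟨Q, hQ, hQh, hQf⟩ :=
        exists_coeff_le_of_algHeight_le MvPolynomial.totalDegree_zero hf hh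
      exact isAlgebraic_and_degree_height_le hp
        (exists_annihilating_diagLaurentSeries hP hPd hPf hQ hQh hQf)
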